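/- Let $d\ge 1$, $p=\frac{2d+1}{4d}$ and $\alpha>\frac12$. Let $e_1,\dots,e_d$ be the standard basis of $\mathbb R^d$, and let $J_d$ be the cyclic permutation matrix of order $d$ with $(J_d)_{i,i+1}=1$ for $1\le i<d$, $(J_d)_{d,1}=1$, and all other entries $0$. The multidimensional elephant random walk with random step sizes is given, on a probability space, by directions $(X_n)_{n\ge1}$, random matrices $(A_n)_{n\ge2}$, random times $(\beta(n))_{n\ge1}$ and step sizes $(Y_n)_{n\ge1}$ such that: - $X_1$ is uniformly distributed on $\{\pm e_1,\dots,\pm e_d\}$, and $X_{n+1}=A_{n+1}X_{\beta(n)}$ almost surely for $n\ge1$; - for $n\ge 1$, $\beta(n)$ is uniformly distributed on $\{1,\dots,n\}$, and $A_{n+1}$ equals $I_d$ with probability $p$ and each of the $2d-1$ matrices $-I_d,\pm J_d,\dots,\pm J_d^{d-1}$ with probability $\frac{1-p}{2d-1}$; - $Y_1>0$ almost surely, with finite mean and variance; $Y_2,Y_3,\dots$ are non-negative, independent and identically distributed with finite mean and variance; - for every $n\ge1$, the random variables $A_{n+1}$, $\beta(n)$, $Y_{n+1}$ are mutually independent,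 and the triple $(A_{n+1},\beta(n),Y_{n+1})$ is independent of $(X_1,\dots,X_n,Y_1,\dots,Y_n)$. Let $T_1=X_1Y_1$, $T_{n+1}=A_{n+1}X_{\beta(n)}Y_{n+1}$ for $n\ge1$, and $S_n=\sum_{k=1}^nT_k$. Then $$\lim_{n\to\infty}\frac{S_n}{\sqrt n\,(\log n)^{\alpha}}=0\quad\text{almost surely.}$$ -/

import Mathlib

open MeasureTheory ProbabilityTheory Filter Topology
open scoped Matrix

namespace MERW

/-- The cyclic permutation matrix `J_d`, with ones at the positions `(i, i + 1)` (cyclically). -/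
def shiftMatrix (d : ℕ) : Matrix (Fin d) (Fin d) ℝ :=
  Matrix.of fun i j => if (j : ℕ) = ((i : ℕ) + 1) % d then 1 else 0

/-- The data driving a `d`-dimensional elephant random walk with memory parameter `p` and random
step sizes: directions `X n` (`n ≥ 1`), random matrices `A n` (`n ≥ 2`), recalled times `β n`
(`n ≥ 1`) and step sizes `Y n` (`n ≥ 1`). All other indices are irrelevant. -/
structure IsModel {Ω : Type*} [MeasurableSpace Ω] (P : Measure Ω) (d : ℕ) (p : ℝ)
    (X : ℕ → Ω → (Fin d → ℝ)) (A : ℕ → Ω → Matrix (Fin d) (Fin d) ℝ)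
    (β : ℕ → Ω → ℕ) (Y : ℕ → Ω → ℝ) : Prop where
  measurable_X : ∀ n, 1 ≤ n → Measurable (X n)
  measurable_A : ∀ n, 1 ≤ n → ∀ i j, Measurable fun ω => A (n + 1) ω i j
  measurable_β : ∀ n, 1 ≤ n → Measurable (β n)
  measurable_Y : ∀ n, 1 ≤ n → Measurable (Y n)
  /-- `X 1` is uniform on the `2d` vectors `±e_i`. -/
  law_X_one : ∀ i : Fin d,
    P.real {ω | X 1 ω = Pi.single i 1} = 1 / (2 * (d : ℝ)) ∧
    P.real {ω | X 1 ω = -Pi.single i 1} = 1 / (2 * (d : ℝ))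
  /-- `A (n + 1)` is `I` with probability `p` and each of the other `2d - 1` signed powers of `J`
  with probability `(1 - p) / (2d - 1)`. -/
  law_A_one : ∀ n, 1 ≤ n → P.real {ω | A (n + 1) ω = 1} = p
  law_A_neg_one : ∀ n, 1 ≤ n →
    P.real {ω | A (n + 1) ω = -1} = (1 - p) / (2 * (d : ℝ) - 1)
  law_A_pow : ∀ n, 1 ≤ n → ∀ i, 1 ≤ i → i < d →
    P.real {ω | A (n + 1) ω = shiftMatrix d ^ i} = (1 - p) / (2 * (d : ℝ) - 1) ∧
    P.real {ω | A (n + 1) ω = -shiftMatrix d ^ i} = (1 - p) / (2 * (d : ℝ) - 1)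
  /-- `β n` is uniform on `{1, …, n}`. -/
  law_β : ∀ n, 1 ≤ n → ∀ k ∈ Finset.Icc 1 n, P.real {ω | β n ω = k} = 1 / (n : ℝ)
  /-- Each new direction is obtained from a recalled one. -/
  X_succ : ∀ n, 1 ≤ n → ∀ᵐ ω ∂P, X (n + 1) ω = A (n + 1) ω *ᵥ X (β n ω) ω
  Y_one_pos : ∀ᵐ ω ∂P, 0 < Y 1 ω
  Y_nonneg : ∀ n, 2 ≤ n → ∀ᵐ ω ∂P, 0 ≤ Y n ω
  /-- Finite mean and variance. -/
  memLp_Y : ∀ n, 1 ≤ n → MemLp (Y n) 2 P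
  identDistrib_Y : ∀ n, 2 ≤ n → IdentDistrib (Y n) (Y 2) P P
  /-- The next two fields: `A (n + 1)`, `β n`, `Y (n + 1)` are mutually independent. -/
  indep_A_β : ∀ n, 1 ≤ n →
    IndepFun (fun ω (i j : Fin d) => A (n + 1) ω i j) (β n) P
  indep_Aβ_Y : ∀ n, 1 ≤ n →
    IndepFun (fun ω => ((fun i j : Fin d => A (n + 1) ω i j), β n ω)) (Y (n + 1)) P
  /-- The triple is independent of the past `X 1, …, X n, Y 1, …, Y n`. Together with
  `identDistrib_Y` this makes `Y 2, Y 3, …` independent and identically distributed. -/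
  indep_past : ∀ n, 1 ≤ n →
    IndepFun (fun ω => ((fun i j : Fin d => A (n + 1) ω i j), β n ω, Y (n + 1) ω))
      (fun ω (k : Finset.Icc 1 n) => (X k ω, Y k ω)) P

/-- The steps: `T 1 = X 1 Y 1` and `T (n + 1) = A (n + 1) X (β n) Y (n + 1)` for `n ≥ 1`. -/
def step {Ω : Type*} {d : ℕ} (X : ℕ → Ω → (Fin d → ℝ)) (A : ℕ → Ω → Matrix (Fin d) (Fin d) ℝ)
    (β : ℕ → Ω → ℕ) (Y : ℕ → Ω → ℝ) : ℕ → Ω → (Fin d → ℝ)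
  | 0 => fun _ => 0
  | 1 => fun ω => Y 1 ω • X 1 ω
  | n + 2 => fun ω => Y (n + 2) ω • (A (n + 2) ω *ᵥ X (β (n + 1) ω) ω)

/-- The position `S n = T 1 + ⋯ + T n`. -/
def position {Ω : Type*} {d : ℕ} (X : ℕ → Ω → (Fin d → ℝ))
    (A : ℕ → Ω → Matrix (Fin d) (Fin d) ℝ)
    (β : ℕ → Ω → ℕ) (Y : ℕ → Ω → ℝ) (n : ℕ) (ω : Ω) : Fin d → ℝ :=
  ∑ k ∈ Finset.Icc 1 n, step X A β Y k ω

end MERW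

/-!
If a square-integrable process satisfies `E[S (n + 1)² | ℱ n] ≤ (1 + 1 / n) S n² + C`, then for
`r > 1` the weights `w n = 1 / (n (1 + log n) ^ r)` are summable and satisfy
`w (n + 1) (1 + 1 / n) ≤ w n`, so `w n * S n²` is a supermartingale up to a summable error and
converges almost surely. Comparing two exponents `1 < r < s` gives `S n² = o(n (log n) ^ s)`.

Each `A (n + 1)` has mean `a I` with `a = p - (1 - p) / (2d - 1)`, and `a ≤ 1 / 2` exactly when
`p ≤ (2d + 1) / (4d)`. Let `μ` be the mean of `Y 2`. In each coordinate `i` the sum of the `X k i`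
has conditional drift `a / n` times its value, and the sum of the `(Y k - μ) X k i` has drift `0`,
so both satisfy the recursion above; the position is the second plus `μ` times the first.
-/

namespace MERW

section AlmostSupermartingale

variable {Ω : Type*} {m : MeasurableSpace Ω} {P : Measure Ω} [IsFiniteMeasure P]
  {ℱ : Filtration ℕ m} {V : ℕ → Ω → ℝ} {a c w : ℕ → ℝ}

theorem supermartingale_sub_sum (hadp : StronglyAdapted ℱ V) (hint : ∀ n, Integrable (V n) P)
    (hstep : ∀ n, P[V (n + 1) | ℱ n] ≤ᵐ[P] fun ω => V n ω + c n) :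
    Supermartingale (fun n ω => V n ω - ∑ k ∈ Finset.range n, c k) ℱ P := by
  refine supermartingale_nat (fun n => (hadp n).sub stronglyMeasurable_const)
    (fun n => (hint n).sub (integrable_const _)) fun n => ?_
  filter_upwards [hstep n, condExp_sub (hint (n + 1))
    (integrable_const (∑ k ∈ Finset.range (n + 1), c k)) (ℱ n)] with ω hω hsub
  rw [Pi.sub_apply, condExp_const (ℱ.le n)] at hsub
  refine hsub.trans_le ?_
  rw [Finset.sum_range_succ]
  linarith

/-- The deterministic case of the Robbins–Siegmund theorem. -/
theorem ae_exists_tendsto_of_condExp_le_add (hadp : StronglyAdapted ℱ V)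
    (hint : ∀ n, Integrable (V n) P) (hnonneg : ∀ n, 0 ≤ᵐ[P] V n)
    (hstep : ∀ n, P[V (n + 1) | ℱ n] ≤ᵐ[P] fun ω => V n ω + c n) (hc : Summable c) :
    ∀ᵐ ω ∂P, ∃ l, Tendsto (fun n => V n ω) atTop (𝓝 l) := by
  set U : ℕ → Ω → ℝ := fun n ω => V n ω - ∑ k ∈ Finset.range n, c k with hU
  have hsuper : Supermartingale U ℱ P := supermartingale_sub_sum hadp hint hstep
  set B : ℝ := ∑' k, |c k|
  have hB : ∀ n, |∑ k ∈ Finset.range n, c k| ≤ B := fun n =>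
    (Finset.abs_sum_le_sum_abs _ _).trans (hc.abs.sum_le_tsum _ fun k _ => abs_nonneg _)
  have hmean : ∀ n, ∫ ω, U n ω ∂P ≤ ∫ ω, U 0 ω ∂P := fun n => by
    simpa using hsuper.setIntegral_le (Nat.zero_le n) MeasurableSet.univ
  have hnorm : ∀ n, ∫ ω, ‖(-U) n ω‖ ∂P ≤ ∫ ω, (U 0 ω + 2 * B) ∂P := fun n => by
    calc ∫ ω, ‖(-U) n ω‖ ∂P ≤ ∫ ω, (U n ω + 2 * B) ∂P := by
          refine integral_mono_ae (hsuper.neg.integrable n).norm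
            ((hsuper.integrable n).add (integrable_const _)) ?_
          filter_upwards [hnonneg n] with ω hω
          have hω' : 0 ≤ V n ω := hω
          have := abs_le.1 (hB n)
          simp only [hU, Pi.neg_apply, norm_neg, Real.norm_eq_abs]
          exact abs_le.2 ⟨by linarith, by linarith⟩
      _ ≤ ∫ ω, (U 0 ω + 2 * B) ∂P := by
          rw [integral_add (hsuper.integrable n) (integrable_const _),
            integral_add (hsuper.integrable 0) (integrable_const _)]
          linarith [hmean n]
  have hbdd : ∀ n, eLpNorm ((-U) n) 1 P ≤ (∫ ω, (U 0 ω + 2 * B) ∂P).toNNReal := fun n => by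
    rw [eLpNorm_one_eq_lintegral_enorm,
      ← ofReal_integral_norm_eq_lintegral_enorm (hsuper.neg.integrable n)]
    exact ENNReal.ofReal_le_ofReal (hnorm n)
  filter_upwards [hsuper.neg.exists_ae_tendsto_of_bdd hbdd] with ω ⟨l, hl⟩
  refine ⟨-l + ∑' k, c k, (hl.neg.add hc.hasSum.tendsto_sum_nat).congr fun n => ?_⟩
  simp [hU]

theorem ae_exists_tendsto_mul_of_condExp_le_mul_add (hadp : StronglyAdapted ℱ V)
    (hint : ∀ n, Integrable (V n) P) (hnonneg : ∀ n, 0 ≤ᵐ[P] V n)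
    (hstep : ∀ n, P[V (n + 1) | ℱ n] ≤ᵐ[P] fun ω => a n * V n ω + c n)
    (hw : ∀ n, 0 ≤ w n) (hwa : ∀ n, w (n + 1) * a n ≤ w n)
    (hwc : Summable fun n => w (n + 1) * c n) :
    ∀ᵐ ω ∂P, ∃ l, Tendsto (fun n => w n * V n ω) atTop (𝓝 l) := by
  refine ae_exists_tendsto_of_condExp_le_add (ℱ := ℱ) (V := fun n => w n • V n)
    (fun n => (hadp n).const_smul _) (fun n => (hint n).smul _) (fun n => ?_) (fun n => ?_) hwc
  · filter_upwards [hnonneg n] with ω hω using mul_nonneg (hw n) hω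
  · filter_upwards [condExp_smul (w (n + 1)) (V (n + 1)) (ℱ n), hstep n, hnonneg n]
      with ω hsmul hω hV
    calc (P[w (n + 1) • V (n + 1) | ℱ n]) ω
        = w (n + 1) * (P[V (n + 1) | ℱ n]) ω := hsmul
      _ ≤ w (n + 1) * (a n * V n ω + c n) := mul_le_mul_of_nonneg_left hω (hw _)
      _ = w (n + 1) * a n * V n ω + w (n + 1) * c n := by ring
      _ ≤ w n * V n ω + w (n + 1) * c n := by
          gcongr
          exact hwa n

end AlmostSupermartingale

section LogWeight

/-- The summable weights that turn the recursion `v (n + 1) ≤ (1 + 1 / n) * v n + c` into a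
bounded one when `1 < r`. The `max` and the summand `1` only serve to keep the weight positive at
`n = 0` and `n = 1`. -/
noncomputable def logWeight (r : ℝ) (n : ℕ) : ℝ := (max (n : ℝ) 1 * (1 + Real.log n) ^ r)⁻¹

variable {r s : ℝ}

theorem logWeight_pos (r : ℝ) (n : ℕ) : 0 < logWeight r n := by
  have := Real.log_natCast_nonneg n
  unfold logWeight
  positivity

theorem logWeight_of_one_le (r : ℝ) {n : ℕ} (hn : 1 ≤ n) :
    logWeight r n = (n * (1 + Real.log n) ^ r)⁻¹ := by
  rw [logWeight, max_eq_left (by exact_mod_cast hn)]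

theorem logWeight_antitone (hr : 0 ≤ r) : AntitoneOn (logWeight r) (Set.Ici 1) := by
  intro m (hm : 1 ≤ m) n _ hmn
  have := Real.log_natCast_nonneg m
  unfold logWeight
  gcongr

theorem logWeight_succ_mul_le (hr : 0 ≤ r) (n : ℕ) :
    logWeight r (n + 1) * (1 + 1 / (n : ℝ)) ≤ logWeight r n := by
  rcases Nat.eq_zero_or_pos n with rfl | hn
  · simp [logWeight]
  have := Real.log_natCast_nonneg n
  calc logWeight r (n + 1) * (1 + 1 / (n : ℝ))
      = (n * (1 + Real.log (n + 1 : ℕ)) ^ r)⁻¹ := by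
        rw [logWeight_of_one_le r n.succ_pos]
        push_cast
        field_simp
    _ ≤ (n * (1 + Real.log n) ^ r)⁻¹ := by gcongr; omega
    _ = logWeight r n := (logWeight_of_one_le r hn).symm

theorem summable_logWeight (hr : 1 < r) : Summable (logWeight r) := by
  rw [← summable_condensed_iff_of_nonneg (fun n => (logWeight_pos r n).le)
    fun m n hm hmn => logWeight_antitone (by linarith) hm (hm.trans_le hmn : 1 ≤ n) hmn]
  have hlog2 : 0 < Real.log 2 := Real.log_pos one_lt_two
  have hpseries : Summable fun k : ℕ => (Real.log 2 ^ r)⁻¹ * ((k + 1 : ℕ) ^ r : ℝ)⁻¹ :=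
    ((summable_nat_add_iff 1).2 (Real.summable_nat_rpow_inv.2 hr)).mul_left _
  rw [← summable_nat_add_iff 1]
  refine hpseries.of_nonneg_of_le
    (fun k => mul_nonneg (by positivity) (logWeight_pos r _).le) fun k => ?_
  calc (2 : ℝ) ^ (k + 1) * logWeight r (2 ^ (k + 1))
      = ((1 + (k + 1 : ℕ) * Real.log 2) ^ r)⁻¹ := by
        rw [logWeight_of_one_le r Nat.one_le_two_pow]
        push_cast
        rw [Real.log_pow]
        push_cast
        field_simp
    _ ≤ (((k + 1 : ℕ) * Real.log 2) ^ r)⁻¹ := by gcongr; linarith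
    _ = (Real.log 2 ^ r)⁻¹ * ((k + 1 : ℕ) ^ r : ℝ)⁻¹ := by
        rw [Real.mul_rpow (by positivity) hlog2.le, mul_inv, mul_comm]

theorem isLittleO_rpow_rpow_atTop (hrs : r < s) :
    (fun x : ℝ => x ^ r) =o[atTop] fun x => x ^ s := by
  refine Asymptotics.isLittleO_of_tendsto' ?_
    ((tendsto_rpow_neg_atTop (sub_pos.2 hrs)).congr' ?_)
  · filter_upwards [eventually_gt_atTop 0] with x hx hzero
    exact absurd hzero (Real.rpow_pos_of_pos hx s).ne'
  · filter_upwards [eventually_gt_atTop 0] with x hx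
    rw [neg_sub, Real.rpow_sub hx]

theorem isLittleO_one_add_rpow_rpow (hr : 0 ≤ r) (hrs : r < s) :
    (fun x : ℝ => (1 + x) ^ r) =o[atTop] fun x => x ^ s := by
  have hlin : (fun x : ℝ => 1 + x) =O[atTop] fun x => x :=
    (Asymptotics.isLittleO_const_id_atTop (1 : ℝ)).isBigO.add (Asymptotics.isBigO_refl _ _)
  exact (hlin.rpow hr (eventually_ge_atTop 0)).trans_isLittleO (isLittleO_rpow_rpow_atTop hrs)

theorem isLittleO_inv_mul_log_rpow_logWeight (hr : 0 ≤ r) (hrs : r < s) :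
    (fun n : ℕ => ((n : ℝ) * Real.log n ^ s)⁻¹) =o[atTop] logWeight r := by
  have hlog : Tendsto (fun n : ℕ => Real.log n) atTop atTop :=
    Real.tendsto_log_atTop.comp tendsto_natCast_atTop_atTop
  have hmul : (fun n : ℕ => (n : ℝ) * (1 + Real.log n) ^ r) =o[atTop]
      fun n => (n : ℝ) * Real.log n ^ s :=
    (Asymptotics.isBigO_refl _ _).mul_isLittleO
      ((isLittleO_one_add_rpow_rpow hr hrs).comp_tendsto hlog)
  refine (hmul.inv_rev ?_).congr' EventuallyEq.rfl ?_
  · filter_upwards [eventually_ge_atTop 1] with n hn hzero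
    have := Real.log_natCast_nonneg n
    exact absurd hzero (by positivity)
  · filter_upwards [eventually_ge_atTop 1] with n hn using (logWeight_of_one_le r hn).symm

end LogWeight

section Growth

variable {Ω : Type*} {m : MeasurableSpace Ω} {P : Measure Ω} [IsFiniteMeasure P]
  {ℱ : Filtration ℕ m}

-- At `n = 0` the coefficient `1 / n` below is `0`.
theorem ae_tendsto_inv_mul_log_rpow_mul {V : ℕ → Ω → ℝ} {C s : ℝ} (hadp : StronglyAdapted ℱ V)
    (hint : ∀ n, Integrable (V n) P) (hnonneg : ∀ n, 0 ≤ᵐ[P] V n)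
    (hstep : ∀ n : ℕ, P[V (n + 1) | ℱ n] ≤ᵐ[P] fun ω => (1 + 1 / (n : ℝ)) * V n ω + C)
    (hs : 1 < s) :
    ∀ᵐ ω ∂P, Tendsto (fun n : ℕ => ((n : ℝ) * Real.log n ^ s)⁻¹ * V n ω) atTop (𝓝 0) := by
  obtain ⟨r, hr, hrs⟩ := exists_between hs
  have hr0 : 0 ≤ r := by linarith
  filter_upwards [ae_exists_tendsto_mul_of_condExp_le_mul_add hadp hint hnonneg hstep
    (fun n => (logWeight_pos r n).le) (logWeight_succ_mul_le hr0)
    (((summable_nat_add_iff 1).2 (summable_logWeight hr)).mul_right C)] with ω ⟨l, hl⟩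
  have hratio := (isLittleO_inv_mul_log_rpow_logWeight hr0 hrs).tendsto_div_nhds_zero
  refine ((hratio.mul hl).congr fun n => ?_).trans_eq (by rw [zero_mul])
  rw [← mul_assoc, div_mul_cancel₀ _ (logWeight_pos r n).ne']

theorem condExp_sq_succ_le {S : ℕ → Ω → ℝ} {C : ℝ} {n : ℕ} (hadp : StronglyAdapted ℱ S)
    (hL2 : ∀ n, MemLp (S n) 2 P)
    (hdrift : ∀ᵐ ω ∂P, S n ω * (P[S (n + 1) - S n | ℱ n]) ω ≤ S n ω ^ 2 / (2 * n))
    (hsq : P[(S (n + 1) - S n) ^ 2 | ℱ n] ≤ᵐ[P] fun _ => C) :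
    P[S (n + 1) ^ 2 | ℱ n] ≤ᵐ[P] fun ω => (1 + 1 / (n : ℝ)) * (S n ^ 2) ω + C := by
  set D : Ω → ℝ := S (n + 1) - S n with hD
  have hDL2 : MemLp D 2 P := (hL2 (n + 1)).sub (hL2 n)
  have hSD : Integrable (S n * D) P := (hL2 n).integrable_mul hDL2
  have hSsq : Integrable (S n ^ 2) P := (hL2 n).integrable_sq
  have hDsq : Integrable (D ^ 2) P := hDL2.integrable_sq
  have hexpand : S (n + 1) ^ 2 = S n ^ 2 + (2 : ℝ) • (S n * D) + D ^ 2 := by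
    ext ω
    simp only [hD, Pi.add_apply, Pi.smul_apply, Pi.mul_apply, Pi.sub_apply, Pi.pow_apply,
      smul_eq_mul]
    ring
  rw [hexpand]
  filter_upwards [hdrift, hsq,
    condExp_add (hSsq.add (hSD.smul (2 : ℝ))) hDsq (ℱ n),
    condExp_add hSsq (hSD.smul (2 : ℝ)) (ℱ n),
    condExp_smul (2 : ℝ) (S n * D) (ℱ n),
    condExp_mul_of_stronglyMeasurable_left (hadp n) hSD (hDL2.integrable one_le_two)]
    with ω hdrift hsq hadd hadd' hsmul hpull
  have hself : P[S n ^ 2 | ℱ n] = S n ^ 2 :=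
    condExp_of_stronglyMeasurable (ℱ.le n) ((hadp n).pow 2) hSsq
  rw [hself] at hadd'
  rw [hadd, Pi.add_apply, hadd', Pi.add_apply, hsmul, Pi.smul_apply, hpull, Pi.mul_apply,
    Pi.pow_apply, smul_eq_mul]
  have : S n ω ^ 2 / (2 * n) * 2 = 1 / n * S n ω ^ 2 := by ring
  linarith

theorem ae_tendsto_inv_sqrt_mul_log_rpow_mul {S : ℕ → Ω → ℝ} {C α : ℝ}
    (hadp : StronglyAdapted ℱ S) (hL2 : ∀ n, MemLp (S n) 2 P)
    (hdrift : ∀ n : ℕ, ∀ᵐ ω ∂P,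
      S n ω * (P[S (n + 1) - S n | ℱ n]) ω ≤ S n ω ^ 2 / (2 * n))
    (hsq : ∀ n, P[(S (n + 1) - S n) ^ 2 | ℱ n] ≤ᵐ[P] fun _ => C) (hα : 1 / 2 < α) :
    ∀ᵐ ω ∂P, Tendsto (fun n : ℕ => (Real.sqrt n * Real.log n ^ α)⁻¹ * S n ω) atTop (𝓝 0) := by
  filter_upwards [ae_tendsto_inv_mul_log_rpow_mul (V := fun n => S n ^ 2) (s := 2 * α)
    (fun n => (hadp n).pow 2) (fun n => (hL2 n).integrable_sq)
    (fun n => Eventually.of_forall fun ω => sq_nonneg (S n ω))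
    (fun n => condExp_sq_succ_le hadp hL2 (hdrift n) (hsq n)) (by linarith)] with ω hω
  rw [tendsto_zero_iff_abs_tendsto_zero]
  refine ((Real.continuous_sqrt.tendsto 0).comp hω |>.congr fun n => ?_).trans_eq
    (by rw [Real.sqrt_zero])
  have hsquare : ((n : ℝ) * Real.log n ^ (2 * α))⁻¹ * (S n ^ 2) ω =
      ((Real.sqrt n * Real.log n ^ α)⁻¹ * S n ω) ^ 2 := by
    rw [mul_pow, inv_pow, mul_pow, Real.sq_sqrt n.cast_nonneg, ← Real.rpow_natCast (_ ^ α),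
      ← Real.rpow_mul (Real.log_natCast_nonneg n), Pi.pow_apply, mul_comm 2 α, Nat.cast_ofNat]
  rw [Function.comp_apply, hsquare, Real.sqrt_sq_eq_abs, Function.comp_apply]

end Growth

section FiniteLaw

variable {Ω ι E F : Type*} [MeasurableSpace Ω] {P : Measure Ω} [Fintype ι] [MeasurableSpace E]
  [MeasurableSingletonClass E] {f : Ω → E} {v : ι → E}

theorem ae_exists_eq_of_sum_measureReal_eq_one [IsProbabilityMeasure P] (hf : Measurable f)
    (hv : Function.Injective v) (hsum : ∑ i, P.real {ω | f ω = v i} = 1) :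
    ∀ᵐ ω ∂P, ∃ i, f ω = v i := by
  have hmeas : ∀ i, MeasurableSet {ω | f ω = v i} := fun i => hf (measurableSet_singleton (v i))
  have hdisj : Pairwise (Function.onFun Disjoint fun i => {ω | f ω = v i}) :=
    (pairwise_disjoint_fiber f).comp_of_injective hv
  have huniv : P.real (⋃ i, {ω | f ω = v i}) = 1 := by
    rw [measureReal_iUnion_fintype hdisj hmeas, hsum]
  filter_upwards [(mem_ae_iff_prob_eq_one (MeasurableSet.iUnion hmeas)).2
    ((ENNReal.toReal_eq_one_iff _).1 huniv)] with ω hω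
  exact Set.mem_iUnion.1 hω

theorem integral_comp_eq_sum_measureReal_smul [NormedAddCommGroup F] [NormedSpace ℝ F]
    [CompleteSpace F] [IsFiniteMeasure P] (hf : Measurable f) (hv : Function.Injective v)
    (hrange : ∀ᵐ ω ∂P, ∃ i, f ω = v i) (g : E → F) :
    ∫ ω, g (f ω) ∂P = ∑ i, P.real {ω | f ω = v i} • g (v i) := by
  have hmeas : ∀ i, MeasurableSet {ω | f ω = v i} := fun i => hf (measurableSet_singleton (v i))
  have hdisj : Pairwise (Function.onFun Disjoint fun i => {ω | f ω = v i}) :=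
    (pairwise_disjoint_fiber f).comp_of_injective hv
  have hconst : ∀ i, Set.EqOn (fun ω => g (f ω)) (fun _ => g (v i)) {ω | f ω = v i} :=
    fun i ω (hω : f ω = v i) => congrArg g hω
  have hcover : (⋃ i, {ω | f ω = v i}) =ᵐ[P] Set.univ := by
    filter_upwards [hrange] with ω hω
    exact propext (iff_true_intro (Set.mem_iUnion.2 hω))
  rw [← setIntegral_univ, ← setIntegral_congr_set hcover,
    integral_iUnion_fintype hmeas hdisj fun i =>
      (integrableOn_const (by finiteness)).congr_fun (hconst i).symm (hmeas i)]
  exact Finset.sum_congr rfl fun i _ => by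
    rw [setIntegral_congr_fun (hmeas i) (hconst i), setIntegral_const]

end FiniteLaw

section SignedShift

/-- The vector `±e_i`, encoded by the pair of its sign and `i`. -/
def signedSingle {ι : Type*} [DecidableEq ι] (s : ℤˣ × ι) : ι → ℝ :=
  Pi.single s.2 ((s.1 : ℤ) : ℝ)

theorem abs_cast_units (ε : ℤˣ) : |((ε : ℤ) : ℝ)| = 1 := by
  rcases Int.units_eq_one_or ε with rfl | rfl <;> simp

theorem abs_signedSingle_le_one {ι : Type*} [DecidableEq ι] (s : ℤˣ × ι) (i : ι) :
    |signedSingle s i| ≤ 1 := by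
  rw [signedSingle, Pi.single_apply]
  split_ifs
  · exact (abs_cast_units s.1).le
  · simp

theorem signedSingle_injective {ι : Type*} [DecidableEq ι] :
    Function.Injective (signedSingle (ι := ι)) := by
  rintro ⟨ε, i⟩ ⟨δ, j⟩ h
  have hentry := congrFun h i
  by_cases hij : i = j
  · subst hij
    simpa [signedSingle, Units.ext_iff] using hentry
  · simp [signedSingle, hij] at hentry

variable {d : ℕ} [NeZero d]

theorem shiftMatrix_mulVec (x : Fin d → ℝ) (i : Fin d) : (shiftMatrix d *ᵥ x) i = x (i + 1) := by
  have hrow : ∀ j : Fin d, shiftMatrix d i j = if j = i + 1 then 1 else 0 := fun j => by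
    simp [shiftMatrix, Fin.ext_iff, Fin.val_add]
  simp [Matrix.mulVec, dotProduct, hrow]

theorem shiftMatrix_pow_mulVec (k : ℕ) (x : Fin d → ℝ) (i : Fin d) :
    (shiftMatrix d ^ k *ᵥ x) i = x (i + Fin.ofNat d k) := by
  induction k generalizing x with
  | zero => simp
  | succ k ih =>
    rw [pow_succ, ← Matrix.mulVec_mulVec, ih, shiftMatrix_mulVec]
    congr 1
    ext
    simp [Fin.val_add, add_assoc]

/-- The signed power `±J_d ^ k`, encoded by the pair of its sign and `k`. -/
def signedShift (d : ℕ) (s : ℤˣ × Fin d) : Matrix (Fin d) (Fin d) ℝ :=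
  ((s.1 : ℤ) : ℝ) • shiftMatrix d ^ (s.2 : ℕ)

theorem signedShift_mulVec (s : ℤˣ × Fin d) (x : Fin d → ℝ) (i : Fin d) :
    (signedShift d s *ᵥ x) i = (s.1 : ℤ) * x (i + s.2) := by
  rw [signedShift, Matrix.smul_mulVec, Pi.smul_apply, shiftMatrix_pow_mulVec, smul_eq_mul]
  simp

theorem signedShift_apply (s : ℤˣ × Fin d) (i : Fin d) :
    signedShift d s i = signedSingle (s.1, i + s.2) := by
  ext j
  rw [← Matrix.col_apply (signedShift d s), ← Matrix.mulVec_single_one, signedShift_mulVec]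
  simp [signedSingle, Pi.single_apply, eq_comm]

theorem signedShift_injective : Function.Injective (signedShift d) := by
  intro s t h
  have hrow := congrFun h 0
  simpa [signedShift_apply, signedSingle_injective.eq_iff, Prod.ext_iff] using hrow

theorem abs_signedShift_mulVec (s : ℤˣ × Fin d) (x : Fin d → ℝ) (i : Fin d) :
    |(signedShift d s *ᵥ x) i| = |x (i + s.2)| := by
  rw [signedShift_mulVec, abs_mul, abs_cast_units, one_mul]

end SignedShift

section Turn

variable {d : ℕ} {p : ℝ}

/-- The correlation parameter `a` of the walk: the surplus of the probability `p` of repeating the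
recalled direction over that of each other turn. The mean of `A (n + 1)` is `a` times the
identity. -/
noncomputable def memoryDrift (d : ℕ) (p : ℝ) : ℝ := p - (1 - p) / (2 * d - 1)

theorem memoryDrift_le_half (hd : 1 ≤ d) (hp : p ≤ (2 * (d : ℝ) + 1) / (4 * d)) :
    memoryDrift d p ≤ 1 / 2 := by
  have hd' : (1 : ℝ) ≤ d := by exact_mod_cast hd
  have hpos : 0 < 2 * (d : ℝ) - 1 := by linarith
  rw [le_div_iff₀ (by positivity)] at hp
  rw [memoryDrift, sub_le_iff_le_add, ← sub_le_iff_le_add', le_div_iff₀ hpos]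
  linarith

theorem sum_signedShift_apply (i j : Fin d) : ∑ s, signedShift d s i j = 0 := by
  rw [Fintype.sum_prod_type_right]
  simp [UnitsInt.univ, signedShift]

variable [NeZero d]

/-- The probability that `A (n + 1)` is the given signed power of `J_d`. -/
noncomputable def turnWeight (d : ℕ) [NeZero d] (p : ℝ) (s : ℤˣ × Fin d) : ℝ :=
  if s = (1, 0) then p else (1 - p) / (2 * d - 1)

theorem sum_turnWeight_mul (g : ℤˣ × Fin d → ℝ) :
    ∑ s, turnWeight d p s * g s =
      memoryDrift d p * g (1, 0) + (1 - p) / (2 * d - 1) * ∑ s, g s := by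
  have hsplit : ∀ s, turnWeight d p s * g s =
      (if s = (1, 0) then memoryDrift d p * g s else 0) + (1 - p) / (2 * d - 1) * g s := fun s => by
    rw [turnWeight, memoryDrift]
    split_ifs <;> ring
  simp only [hsplit, Finset.sum_add_distrib, Finset.sum_ite_eq', Finset.mem_univ, if_true,
    Finset.mul_sum]

theorem sum_turnWeight : ∑ s, turnWeight d p s = 1 := by
  have hsum := sum_turnWeight_mul (d := d) (p := p) fun _ => 1
  have hd : (1 : ℝ) ≤ d := by exact_mod_cast NeZero.one_le
  have hne : 2 * (d : ℝ) - 1 ≠ 0 := by linarith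
  simp only [mul_one, Finset.sum_const, Finset.card_univ, Fintype.card_prod, Fintype.card_fin,
    Fintype.card_units_int, nsmul_eq_mul, memoryDrift] at hsum
  rw [hsum]
  push_cast
  field_simp
  ring

theorem sum_turnWeight_mul_signedShift_apply (i j : Fin d) :
    ∑ s, turnWeight d p s * signedShift d s i j = if j = i then memoryDrift d p else 0 := by
  rw [sum_turnWeight_mul, sum_signedShift_apply, signedShift_apply]
  simp [signedSingle, Pi.single_apply]

end Turn

section WeightedWalk

variable {Ω : Type*} {d : ℕ}

/-- The `i`-th coordinate of the walk with directions `X` and step sizes `ψ (Y k)`. -/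
noncomputable def weightedWalk (X : ℕ → Ω → (Fin d → ℝ)) (Y : ℕ → Ω → ℝ) (ψ : ℝ → ℝ) (i : Fin d)
    (n : ℕ) (ω : Ω) : ℝ :=
  ∑ k ∈ Finset.Icc 1 n, ψ (Y k ω) * X k ω i

variable (X : ℕ → Ω → (Fin d → ℝ)) (Y : ℕ → Ω → ℝ) (ψ : ℝ → ℝ) (i : Fin d) (n : ℕ)

theorem weightedWalk_zero : weightedWalk X Y ψ i 0 = 0 := by
  ext ω
  simp [weightedWalk]

theorem weightedWalk_succ_sub :
    weightedWalk X Y ψ i (n + 1) - weightedWalk X Y ψ i n =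
      fun ω => ψ (Y (n + 1) ω) * X (n + 1) ω i := by
  ext ω
  simp [weightedWalk, Finset.sum_Icc_succ_top]

theorem weightedWalk_id_eq (μ : ℝ) (ω : Ω) :
    weightedWalk X Y id i n ω =
      weightedWalk X Y (fun y => y - μ) i n ω + μ * weightedWalk X Y (fun _ => 1) i n ω := by
  simp only [weightedWalk, Finset.mul_sum, ← Finset.sum_add_distrib]
  refine Finset.sum_congr rfl fun k _ => ?_
  rw [id]
  ring

end WeightedWalk

namespace IsModel

variable {Ω : Type*} [mΩ : MeasurableSpace Ω] {P : Measure Ω}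
  {d : ℕ} {p : ℝ} {X : ℕ → Ω → (Fin d → ℝ)} {A : ℕ → Ω → Matrix (Fin d) (Fin d) ℝ}
  {β : ℕ → Ω → ℕ} {Y : ℕ → Ω → ℝ}

section Bounded

theorem measurable_matrix (h : IsModel P d p X A β Y) {n : ℕ} (hn : 1 ≤ n) :
    Measurable fun ω (i j : Fin d) => A (n + 1) ω i j :=
  measurable_pi_lambda _ fun i => measurable_pi_lambda _ fun j => h.measurable_A n hn i j

theorem measureReal_X_one_eq (h : IsModel P d p X A β Y) (s : ℤˣ × Fin d) :
    P.real {ω | X 1 ω = signedSingle s} = 1 / (2 * d) := by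
  rcases s with ⟨ε, i⟩
  rcases Int.units_eq_one_or ε with rfl | rfl
  · simpa [signedSingle] using (h.law_X_one i).1
  · simpa [signedSingle, Pi.single_neg] using (h.law_X_one i).2

theorem measureReal_matrix_eq [NeZero d] (h : IsModel P d p X A β Y) {n : ℕ} (hn : 1 ≤ n)
    (s : ℤˣ × Fin d) :
    P.real {ω | A (n + 1) ω = signedShift d s} = turnWeight d p s := by
  rcases s with ⟨ε, k⟩
  rcases Int.units_eq_one_or ε with rfl | rfl <;> by_cases hk : k = 0
  · simpa [signedShift, turnWeight, hk] using h.law_A_one n hn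
  · simpa [signedShift, turnWeight, hk] using
      (h.law_A_pow n hn k (Nat.one_le_iff_ne_zero.2 (Fin.val_ne_zero_iff.2 hk)) k.2).1
  · simpa [signedShift, turnWeight, hk, Prod.ext_iff] using h.law_A_neg_one n hn
  · simpa [signedShift, turnWeight, hk] using
      (h.law_A_pow n hn k (Nat.one_le_iff_ne_zero.2 (Fin.val_ne_zero_iff.2 hk)) k.2).2

variable [IsProbabilityMeasure P]

theorem ae_exists_signedShift [NeZero d] (h : IsModel P d p X A β Y) {n : ℕ} (hn : 1 ≤ n) :
    ∀ᵐ ω ∂P, ∃ s, A (n + 1) ω = signedShift d s :=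
  ae_exists_eq_of_sum_measureReal_eq_one (E := Fin d → Fin d → ℝ) (h.measurable_matrix hn)
    signedShift_injective
    ((Finset.sum_congr rfl fun s _ => h.measureReal_matrix_eq hn s).trans sum_turnWeight)

theorem ae_exists_signedSingle [NeZero d] (h : IsModel P d p X A β Y) :
    ∀ᵐ ω ∂P, ∃ s, X 1 ω = signedSingle s := by
  refine ae_exists_eq_of_sum_measureReal_eq_one (h.measurable_X 1 le_rfl) signedSingle_injective ?_
  have : (d : ℝ) ≠ 0 := NeZero.ne _
  simp only [h.measureReal_X_one_eq, Finset.sum_const, Finset.card_univ, Fintype.card_prod,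
    Fintype.card_fin, Fintype.card_units_int, nsmul_eq_mul]
  push_cast
  field_simp

theorem ae_recall_mem (h : IsModel P d p X A β Y) {n : ℕ} (hn : 1 ≤ n) :
    ∀ᵐ ω ∂P, β n ω ∈ Finset.Icc 1 n := by
  have hlaw : ∑ k : Finset.Icc 1 n, P.real {ω | β n ω = k} = 1 := by
    have : (n : ℝ) ≠ 0 := by positivity
    simp [h.law_β n hn, this]
  filter_upwards [ae_exists_eq_of_sum_measureReal_eq_one (h.measurable_β n hn)
    Subtype.val_injective hlaw] with ω ⟨k, hk⟩
  exact hk ▸ k.2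

theorem integral_matrix_apply [NeZero d] (h : IsModel P d p X A β Y) {n : ℕ} (hn : 1 ≤ n)
    (i j : Fin d) :
    ∫ ω, A (n + 1) ω i j ∂P = if j = i then memoryDrift d p else 0 := by
  rw [integral_comp_eq_sum_measureReal_smul (E := Fin d → Fin d → ℝ) (h.measurable_matrix hn)
    signedShift_injective (h.ae_exists_signedShift hn) fun M => M i j,
    ← sum_turnWeight_mul_signedShift_apply]
  exact Finset.sum_congr rfl fun s _ => congrArg (· * _) (h.measureReal_matrix_eq hn s)

theorem ae_abs_X_le_one [NeZero d] (h : IsModel P d p X A β Y) :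
    ∀ᵐ ω ∂P, ∀ n, 1 ≤ n → ∀ i, |X n ω i| ≤ 1 := by
  have hsucc : ∀ᵐ ω ∂P, ∀ n, 1 ≤ n → (∃ s, A (n + 1) ω = signedShift d s) ∧
      β n ω ∈ Finset.Icc 1 n ∧ X (n + 1) ω = A (n + 1) ω *ᵥ X (β n ω) ω := by
    refine ae_all_iff.2 fun n => ?_
    by_cases hn : 1 ≤ n
    · filter_upwards [h.ae_exists_signedShift hn, h.ae_recall_mem hn, h.X_succ n hn]
        with ω hA hβ hX _ using ⟨hA, hβ, hX⟩
    · exact Eventually.of_forall fun ω hn' => absurd hn' hn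
  filter_upwards [h.ae_exists_signedSingle, hsucc] with ω ⟨s, hs⟩ hsucc n hn
  induction n using Nat.strong_induction_on with
  | _ n ih =>
    intro i
    obtain rfl | ⟨m, hm, rfl⟩ : n = 1 ∨ ∃ m, 1 ≤ m ∧ n = m + 1 := by
      rcases n with _ | _ | m
      · omega
      · exact Or.inl rfl
      · exact Or.inr ⟨m + 1, by omega, rfl⟩
    · exact hs ▸ abs_signedSingle_le_one s i
    · obtain ⟨⟨t, ht⟩, hβ, hX⟩ := hsucc m hm
      obtain ⟨hβ_pos, hβ_le⟩ := Finset.mem_Icc.1 hβ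
      rw [hX, ht, abs_signedShift_mulVec]
      exact ih _ (by omega) hβ_pos _

end Bounded

section Innovation

theorem ae_abs_matrix_apply_le_one [IsProbabilityMeasure P] [NeZero d]
    (h : IsModel P d p X A β Y) {n : ℕ} (hn : 1 ≤ n) (i j : Fin d) :
    ∀ᵐ ω ∂P, |A (n + 1) ω i j| ≤ 1 := by
  filter_upwards [h.ae_exists_signedShift hn] with ω ⟨s, hs⟩
  rw [hs, signedShift_apply]
  exact abs_signedSingle_le_one _ _

theorem measurable_past (h : IsModel P d p X A β Y) (n : ℕ) :
    Measurable fun ω (k : Finset.Icc 1 n) => (X k ω, Y k ω) :=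
  measurable_pi_lambda _ fun k => (h.measurable_X k (Finset.mem_Icc.1 k.2).1).prodMk
    (h.measurable_Y k (Finset.mem_Icc.1 k.2).1)

/-- The filtration generated by `X 1, …, X n, Y 1, …, Y n`. -/
def pastFiltration (h : IsModel P d p X A β Y) : Filtration ℕ mΩ where
  seq n := MeasurableSpace.comap (fun ω (k : Finset.Icc 1 n) => (X k ω, Y k ω)) inferInstance
  mono' m n hmn := by
    let restrict (x : Finset.Icc 1 n → (Fin d → ℝ) × ℝ) (k : Finset.Icc 1 m) :=
      x ⟨k, Finset.Icc_subset_Icc_right hmn k.2⟩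
    have hrestrict : Measurable restrict :=
      measurable_pi_lambda _ fun k => measurable_pi_apply _
    rintro s ⟨t, ht, rfl⟩
    exact ⟨restrict ⁻¹' t, hrestrict ht, rfl⟩
  le' n := (h.measurable_past n).comap_le

theorem pastFiltration_zero (h : IsModel P d p X A β Y) : h.pastFiltration 0 = ⊥ := by
  have hconst : (fun ω (k : Finset.Icc 1 0) => (X k ω, Y k ω)) =
      fun _ k => absurd k.2 (by simp) := by
    funext ω k
    exact absurd k.2 (by simp)
  change MeasurableSpace.comap _ _ = ⊥
  rw [hconst, MeasurableSpace.comap_const]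

theorem measurable_pastFiltration (h : IsModel P d p X A β Y) {k n : ℕ}
    (hk : k ∈ Finset.Icc 1 n) : Measurable[h.pastFiltration n] fun ω => (X k ω, Y k ω) :=
  (measurable_pi_apply (⟨k, hk⟩ : Finset.Icc 1 n)).comp
    (comap_measurable fun ω (k : Finset.Icc 1 n) => (X k ω, Y k ω))

theorem stronglyMeasurable_X (h : IsModel P d p X A β Y) {k n : ℕ} (hk : k ∈ Finset.Icc 1 n)
    (i : Fin d) : StronglyMeasurable[h.pastFiltration n] fun ω => X k ω i :=
  ((measurable_pi_apply i).comp
    (measurable_fst.comp (h.measurable_pastFiltration hk))).stronglyMeasurable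

theorem measurable_pastFiltration_Y (h : IsModel P d p X A β Y) {k n : ℕ}
    (hk : k ∈ Finset.Icc 1 n) : Measurable[h.pastFiltration n] (Y k) :=
  measurable_snd.comp (h.measurable_pastFiltration hk)

/-- The randomness that is new at time `n + 1`: the turn, the recalled time and the step size. -/
def innovation (A : ℕ → Ω → Matrix (Fin d) (Fin d) ℝ) (β : ℕ → Ω → ℕ) (Y : ℕ → Ω → ℝ) (n : ℕ)
    (ω : Ω) : (Fin d → Fin d → ℝ) × ℕ × ℝ :=
  (fun i j => A (n + 1) ω i j, β n ω, Y (n + 1) ω)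

theorem measurable_innovation (h : IsModel P d p X A β Y) {n : ℕ} (hn : 1 ≤ n) :
    Measurable (innovation A β Y n) :=
  (h.measurable_matrix hn).prodMk ((h.measurable_β n hn).prodMk (h.measurable_Y _ n.succ_pos))

theorem condExp_comp_innovation [IsProbabilityMeasure P] (h : IsModel P d p X A β Y) {n : ℕ}
    (hn : 1 ≤ n) {φ : (Fin d → Fin d → ℝ) × ℕ × ℝ → ℝ} (hφ : Measurable φ) :
    P[φ ∘ innovation A β Y n | h.pastFiltration n] =ᵐ[P]
      fun _ => ∫ ω, φ (innovation A β Y n ω) ∂P :=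
  condExp_indep_eq (h.measurable_innovation hn).comap_le (h.pastFiltration.le n)
    (hφ.comp (comap_measurable _)).stronglyMeasurable
    ((IndepFun_iff_Indep _ _ _).1 (h.indep_past n hn))

theorem condExp_comp_innovation_mul [IsProbabilityMeasure P] (h : IsModel P d p X A β Y) {n : ℕ}
    (hn : 1 ≤ n) {φ : (Fin d → Fin d → ℝ) × ℕ × ℝ → ℝ} (hφ : Measurable φ) {Z : Ω → ℝ}
    (hZ : StronglyMeasurable[h.pastFiltration n] Z)
    (hint : Integrable (φ ∘ innovation A β Y n) P)
    (hmul : Integrable (φ ∘ innovation A β Y n * Z) P) :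
    P[φ ∘ innovation A β Y n * Z | h.pastFiltration n] =ᵐ[P]
      fun ω => (∫ ω, φ (innovation A β Y n ω) ∂P) * Z ω := by
  filter_upwards [condExp_mul_of_stronglyMeasurable_right hZ hmul hint,
    h.condExp_comp_innovation hn hφ] with ω hpull hconst
  rw [hpull, Pi.mul_apply, hconst]

theorem condExp_comp_Y [IsProbabilityMeasure P] (h : IsModel P d p X A β Y) (n : ℕ) {ψ : ℝ → ℝ}
    (hψ : Measurable ψ) :
    P[fun ω => ψ (Y (n + 1) ω) | h.pastFiltration n] =ᵐ[P]
      fun _ => ∫ ω, ψ (Y (n + 1) ω) ∂P := by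
  rcases Nat.eq_zero_or_pos n with rfl | hn
  · rw [h.pastFiltration_zero, condExp_bot]
  · exact h.condExp_comp_innovation hn (hψ.comp (measurable_snd.comp measurable_snd))

end Innovation

section Drift

/-- The coefficient of `X k j` in `ψ (Y (n + 1)) * X (n + 1) i`, as a function of the innovation at
time `n + 1`. -/
noncomputable def recallCoeff (ψ : ℝ → ℝ) (i j : Fin d) (k : ℕ)
    (u : (Fin d → Fin d → ℝ) × ℕ × ℝ) : ℝ :=
  u.1 i j * ({k} : Set ℕ).indicator 1 u.2.1 * ψ u.2.2

variable {ψ : ℝ → ℝ} {n k : ℕ}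

theorem measurable_entry (i j : Fin d) : Measurable fun M : Fin d → Fin d → ℝ => M i j :=
  (measurable_pi_apply j).comp (measurable_pi_apply i)

theorem measurable_recallCoeff (hψ : Measurable ψ) (i j : Fin d) (k : ℕ) :
    Measurable (recallCoeff ψ i j k) := by
  have hind : Measurable (({k} : Set ℕ).indicator (1 : ℕ → ℝ)) := measurable_from_top
  exact (((measurable_entry i j).comp measurable_fst).mul
    (hind.comp (measurable_fst.comp measurable_snd))).mul
    (hψ.comp (measurable_snd.comp measurable_snd))

theorem abs_recallCoeff_le {i j : Fin d} {u : (Fin d → Fin d → ℝ) × ℕ × ℝ} (hu : |u.1 i j| ≤ 1) :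
    |recallCoeff ψ i j k u| ≤ |ψ u.2.2| := by
  have hind : |({k} : Set ℕ).indicator (1 : ℕ → ℝ) u.2.1| ≤ 1 := by
    rw [Set.indicator_apply]
    split_ifs <;> simp
  rw [recallCoeff, abs_mul, abs_mul]
  exact mul_le_of_le_one_left (abs_nonneg _) (mul_le_one₀ hu (abs_nonneg _) hind)

variable [IsProbabilityMeasure P]

theorem ae_comp_Y_mul_X_succ_eq_sum (h : IsModel P d p X A β Y) (hn : 1 ≤ n) (i : Fin d) :
    (fun ω => ψ (Y (n + 1) ω) * X (n + 1) ω i) =ᵐ[P]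
      ∑ x ∈ Finset.Icc 1 n ×ˢ Finset.univ,
        recallCoeff ψ i x.2 x.1 ∘ innovation A β Y n * fun ω => X x.1 ω x.2 := by
  filter_upwards [h.X_succ n hn, h.ae_recall_mem hn] with ω hX hβ
  rw [Finset.sum_apply, Finset.sum_product, Finset.sum_eq_single_of_mem _ hβ, hX,
    Matrix.mulVec, dotProduct, Finset.mul_sum]
  · refine Finset.sum_congr rfl fun j _ => ?_
    simp only [Pi.mul_apply, Function.comp_apply, recallCoeff, innovation,
      Set.indicator_of_mem (Set.mem_singleton _), Pi.one_apply]
    ring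
  · intro k _ hk
    simp [recallCoeff, innovation, hk.symm]

variable [NeZero d]

theorem integral_recallCoeff (h : IsModel P d p X A β Y) (hψ : Measurable ψ)
    (hk : k ∈ Finset.Icc 1 n) (i j : Fin d) :
    ∫ ω, recallCoeff ψ i j k (innovation A β Y n ω) ∂P =
      (if j = i then memoryDrift d p else 0) * (1 / n) * ∫ ω, ψ (Y (n + 1) ω) ∂P := by
  have hn : 1 ≤ n := (Finset.mem_Icc.1 hk).1.trans (Finset.mem_Icc.1 hk).2
  have hind : Measurable (({k} : Set ℕ).indicator (1 : ℕ → ℝ)) := measurable_from_top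
  have hrecall : ∫ ω, ({k} : Set ℕ).indicator (1 : ℕ → ℝ) (β n ω) ∂P = 1 / (n : ℝ) := by
    rw [← h.law_β n hn k hk]
    exact integral_indicator_one (h.measurable_β n hn (measurableSet_singleton k))
  have hturn_recall : IndepFun (fun ω => A (n + 1) ω i j)
      (fun ω => ({k} : Set ℕ).indicator (1 : ℕ → ℝ) (β n ω)) P :=
    (h.indep_A_β n hn).comp (measurable_entry i j) hind
  have hsize : IndepFun (fun ω => A (n + 1) ω i j * ({k} : Set ℕ).indicator (1 : ℕ → ℝ) (β n ω))
      (fun ω => ψ (Y (n + 1) ω)) P :=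
    (h.indep_Aβ_Y n hn).comp
      (((measurable_entry i j).comp measurable_fst).mul (hind.comp measurable_snd)) hψ
  have hA := h.measurable_A n hn i j
  have hβ := hind.comp (h.measurable_β n hn)
  rw [← h.integral_matrix_apply hn i j, ← hrecall,
    ← hturn_recall.integral_fun_mul_eq_mul_integral hA.aestronglyMeasurable
      hβ.aestronglyMeasurable,
    ← hsize.integral_fun_mul_eq_mul_integral (hA.mul hβ).aestronglyMeasurable
      (hψ.comp (h.measurable_Y _ n.succ_pos)).aestronglyMeasurable]
  rfl

theorem condExp_recallCoeff_mul_X (h : IsModel P d p X A β Y) (hψ : Measurable ψ)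
    (hint : Integrable (fun ω => ψ (Y (n + 1) ω)) P) (hk : k ∈ Finset.Icc 1 n) (i j : Fin d) :
    Integrable (recallCoeff ψ i j k ∘ innovation A β Y n * fun ω => X k ω j) P ∧
    P[recallCoeff ψ i j k ∘ innovation A β Y n * fun ω => X k ω j | h.pastFiltration n] =ᵐ[P]
      fun ω => (if j = i then memoryDrift d p else 0) * (1 / n) *
        (∫ ω, ψ (Y (n + 1) ω) ∂P) * X k ω j := by
  have hk1 : 1 ≤ k := (Finset.mem_Icc.1 hk).1
  have hn : 1 ≤ n := hk1.trans (Finset.mem_Icc.1 hk).2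
  have hcoeff : Integrable (recallCoeff ψ i j k ∘ innovation A β Y n) P := by
    refine hint.mono ((measurable_recallCoeff hψ i j k).comp
      (h.measurable_innovation hn)).aestronglyMeasurable ?_
    filter_upwards [h.ae_abs_matrix_apply_le_one hn i j] with ω hω using abs_recallCoeff_le hω
  have hmul : Integrable (recallCoeff ψ i j k ∘ innovation A β Y n * fun ω => X k ω j) P :=
    hcoeff.mul_bdd (c := 1)
      ((measurable_pi_apply j).comp (h.measurable_X k hk1)).aestronglyMeasurable
      (by filter_upwards [h.ae_abs_X_le_one] with ω hω using hω k hk1 j)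
  refine ⟨hmul, ?_⟩
  rw [← h.integral_recallCoeff hψ hk]
  exact h.condExp_comp_innovation_mul hn (measurable_recallCoeff hψ i j k)
    (h.stronglyMeasurable_X hk j) hcoeff hmul

theorem condExp_comp_Y_mul_X_succ (h : IsModel P d p X A β Y) (hψ : Measurable ψ)
    (hint : Integrable (fun ω => ψ (Y (n + 1) ω)) P) (hn : 1 ≤ n) (i : Fin d) :
    P[fun ω => ψ (Y (n + 1) ω) * X (n + 1) ω i | h.pastFiltration n] =ᵐ[P] fun ω =>
      (∫ ω, ψ (Y (n + 1) ω) ∂P) * (memoryDrift d p / n * ∑ k ∈ Finset.Icc 1 n, X k ω i) := by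
  have hterm := fun (x : ℕ × Fin d) (hx : x ∈ Finset.Icc 1 n ×ˢ Finset.univ) =>
    h.condExp_recallCoeff_mul_X hψ hint (Finset.mem_product.1 hx).1 i x.2
  have hterm_ae := (Finset.eventually_all _).2 fun x hx => (hterm x hx).2
  filter_upwards [condExp_congr_ae (m := h.pastFiltration n) (h.ae_comp_Y_mul_X_succ_eq_sum hn i),
    condExp_finsetSum (fun x hx => (hterm x hx).1) (h.pastFiltration n), hterm_ae]
    with ω hcongr hsum hterm
  rw [hcongr, hsum, Finset.sum_apply, Finset.sum_congr rfl hterm, Finset.sum_product,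
    Finset.mul_sum, Finset.mul_sum]
  refine Finset.sum_congr rfl fun k _ => ?_
  simp only [ite_mul, zero_mul, Finset.sum_ite_eq', Finset.mem_univ, if_true]
  ring

end Drift

section Walk

variable {ψ : ℝ → ℝ} {α : ℝ}

theorem stronglyAdapted_weightedWalk (h : IsModel P d p X A β Y) (hψ : Measurable ψ) (i : Fin d) :
    StronglyAdapted h.pastFiltration (weightedWalk X Y ψ i) := fun _ =>
  Finset.stronglyMeasurable_fun_sum _ fun _ hk =>
    (hψ.comp (h.measurable_pastFiltration_Y hk)).stronglyMeasurable.mul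
      (h.stronglyMeasurable_X hk i)

theorem step_ae_eq (h : IsModel P d p X A β Y) :
    ∀ᵐ ω ∂P, ∀ k, 1 ≤ k → step X A β Y k ω = Y k ω • X k ω := by
  refine ae_all_iff.2 fun k => ?_
  rcases k with _ | _ | k
  · simp
  · simp [step]
  · filter_upwards [h.X_succ (k + 1) k.succ_pos] with ω hω _
    rw [step, hω]

theorem position_apply_ae_eq (h : IsModel P d p X A β Y) :
    ∀ᵐ ω ∂P, ∀ n i, position X A β Y n ω i = weightedWalk X Y id i n ω := by
  filter_upwards [h.step_ae_eq] with ω hω n i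
  rw [position, Finset.sum_apply, weightedWalk]
  refine Finset.sum_congr rfl fun k hk => ?_
  rw [hω k (Finset.mem_Icc.1 hk).1, Pi.smul_apply, smul_eq_mul, id]

theorem integral_comp_Y_eq (h : IsModel P d p X A β Y) {n : ℕ} (hn : 2 ≤ n) (hψ : Measurable ψ) :
    ∫ ω, ψ (Y n ω) ∂P = ∫ ω, ψ (Y 2 ω) ∂P :=
  ((h.identDistrib_Y n hn).comp hψ).integral_eq

variable [IsProbabilityMeasure P] [NeZero d]

theorem memLp_comp_Y_mul_X (h : IsModel P d p X A β Y) {n : ℕ} (hn : 1 ≤ n)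
    (hL2 : MemLp (fun ω => ψ (Y n ω)) 2 P) (i : Fin d) :
    MemLp (fun ω => ψ (Y n ω) * X n ω i) 2 P := by
  have hX : AEStronglyMeasurable (fun ω => X n ω i) P :=
    ((measurable_pi_apply i).comp (h.measurable_X n hn)).aestronglyMeasurable
  refine hL2.mono (hL2.aestronglyMeasurable.mul hX) ?_
  filter_upwards [h.ae_abs_X_le_one] with ω hω
  rw [norm_mul]
  exact mul_le_of_le_one_right (norm_nonneg _) (hω n hn i)

theorem condExp_sq_weightedWalk_succ_sub_le (h : IsModel P d p X A β Y) (hψ : Measurable ψ)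
    (hL2 : ∀ n, 1 ≤ n → MemLp (fun ω => ψ (Y n ω)) 2 P) (i : Fin d) (n : ℕ) :
    P[(weightedWalk X Y ψ i (n + 1) - weightedWalk X Y ψ i n) ^ 2 | h.pastFiltration n] ≤ᵐ[P]
      fun _ => ∫ ω, ψ (Y (n + 1) ω) ^ 2 ∂P := by
  rw [weightedWalk_succ_sub]
  refine (condExp_mono (h.memLp_comp_Y_mul_X n.succ_pos (hL2 _ n.succ_pos) i).integrable_sq
    (hL2 _ n.succ_pos).integrable_sq ?_).trans_eq (h.condExp_comp_Y n (hψ.pow_const 2))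
  filter_upwards [h.ae_abs_X_le_one] with ω hω
  change (ψ (Y (n + 1) ω) * X (n + 1) ω i) ^ 2 ≤ ψ (Y (n + 1) ω) ^ 2
  rw [mul_pow]
  exact mul_le_of_le_one_right (sq_nonneg _) ((sq_le_one_iff_abs_le_one _).2 (hω _ n.succ_pos i))

theorem condExp_weightedWalk_succ_sub (h : IsModel P d p X A β Y) (hψ : Measurable ψ)
    (hL2 : ∀ n, 1 ≤ n → MemLp (fun ω => ψ (Y n ω)) 2 P) (i : Fin d) {n : ℕ} (hn : 1 ≤ n) :
    P[weightedWalk X Y ψ i (n + 1) - weightedWalk X Y ψ i n | h.pastFiltration n] =ᵐ[P] fun ω =>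
      (∫ ω, ψ (Y 2 ω) ∂P) * (memoryDrift d p / n * ∑ k ∈ Finset.Icc 1 n, X k ω i) := by
  rw [weightedWalk_succ_sub, ← h.integral_comp_Y_eq (Nat.succ_le_succ hn) hψ]
  exact h.condExp_comp_Y_mul_X_succ hψ ((hL2 _ n.succ_pos).integrable one_le_two) hn i

theorem ae_tendsto_weightedWalk (h : IsModel P d p X A β Y) (hψ : Measurable ψ)
    (hL2 : ∀ n, 1 ≤ n → MemLp (fun ω => ψ (Y n ω)) 2 P) (i : Fin d)
    (hdrift : ∀ (n : ℕ) ω, weightedWalk X Y ψ i n ω *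
        ((∫ ω, ψ (Y 2 ω) ∂P) * (memoryDrift d p / n * ∑ k ∈ Finset.Icc 1 n, X k ω i)) ≤
      weightedWalk X Y ψ i n ω ^ 2 / (2 * n)) (hα : 1 / 2 < α) :
    ∀ᵐ ω ∂P, Tendsto (fun n : ℕ => (Real.sqrt n * Real.log n ^ α)⁻¹ * weightedWalk X Y ψ i n ω)
      atTop (𝓝 0) := by
  set C : ℝ := max (∫ ω, ψ (Y 1 ω) ^ 2 ∂P) (∫ ω, ψ (Y 2 ω) ^ 2 ∂P)
  have hC : ∀ n, ∫ ω, ψ (Y (n + 1) ω) ^ 2 ∂P ≤ C := fun n => by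
    rcases Nat.eq_zero_or_pos n with rfl | hn
    · exact le_max_left _ _
    · exact (h.integral_comp_Y_eq (Nat.succ_le_succ hn) (hψ.pow_const 2)).trans_le
        (le_max_right _ _)
  refine ae_tendsto_inv_sqrt_mul_log_rpow_mul (C := C) (h.stronglyAdapted_weightedWalk hψ i)
    (fun n => memLp_finsetSum _ fun k hk =>
      h.memLp_comp_Y_mul_X (Finset.mem_Icc.1 hk).1 (hL2 k (Finset.mem_Icc.1 hk).1) i)
    (fun n => ?_)
    (fun n => (h.condExp_sq_weightedWalk_succ_sub_le hψ hL2 i n).trans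
      (Eventually.of_forall fun _ => hC n)) hα
  rcases Nat.eq_zero_or_pos n with rfl | hn
  · simp [weightedWalk_zero]
  · filter_upwards [h.condExp_weightedWalk_succ_sub hψ hL2 i hn] with ω hω
    rw [hω]
    exact hdrift n ω

theorem ae_tendsto_weightedWalk_one (h : IsModel P d p X A β Y) (ha : memoryDrift d p ≤ 1 / 2)
    (i : Fin d) (hα : 1 / 2 < α) :
    ∀ᵐ ω ∂P, Tendsto (fun n : ℕ => (Real.sqrt n * Real.log n ^ α)⁻¹ *
      weightedWalk X Y (fun _ => 1) i n ω) atTop (𝓝 0) := by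
  refine h.ae_tendsto_weightedWalk measurable_const (fun _ _ => memLp_const 1) i (fun n ω => ?_) hα
  simp only [weightedWalk, one_mul, integral_const, probReal_univ, smul_eq_mul]
  set S := ∑ k ∈ Finset.Icc 1 n, X k ω i
  calc S * (memoryDrift d p / n * S) = memoryDrift d p * (S ^ 2 / n) := by ring
    _ ≤ 1 / 2 * (S ^ 2 / n) := by gcongr
    _ = S ^ 2 / (2 * n) := by ring

theorem ae_tendsto_weightedWalk_sub_mean (h : IsModel P d p X A β Y) (i : Fin d)
    (hα : 1 / 2 < α) :
    ∀ᵐ ω ∂P, Tendsto (fun n : ℕ => (Real.sqrt n * Real.log n ^ α)⁻¹ *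
      weightedWalk X Y (fun y => y - ∫ ω, Y 2 ω ∂P) i n ω) atTop (𝓝 0) := by
  have hcentred : ∫ ω, (Y 2 ω - ∫ ω, Y 2 ω ∂P) ∂P = 0 := by
    rw [integral_sub ((h.memLp_Y 2 one_le_two).integrable one_le_two) (integrable_const _)]
    simp
  refine h.ae_tendsto_weightedWalk (measurable_id'.sub_const _)
    (fun n hn => (h.memLp_Y n hn).sub (memLp_const _)) i (fun n ω => ?_) hα
  rw [hcentred, zero_mul, mul_zero]
  positivity

theorem ae_tendsto_position_apply (h : IsModel P d p X A β Y) (ha : memoryDrift d p ≤ 1 / 2)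
    (i : Fin d) (hα : 1 / 2 < α) :
    ∀ᵐ ω ∂P, Tendsto (fun n : ℕ => (Real.sqrt n * Real.log n ^ α)⁻¹ * position X A β Y n ω i)
      atTop (𝓝 0) := by
  filter_upwards [h.position_apply_ae_eq, h.ae_tendsto_weightedWalk_sub_mean i hα,
    h.ae_tendsto_weightedWalk_one ha i hα] with ω hposition hcentred hunit
  refine ((hcentred.add (hunit.const_mul (∫ ω, Y 2 ω ∂P))).congr fun n => ?_).trans_eq (by simp)
  rw [hposition, weightedWalk_id_eq X Y i n (∫ ω, Y 2 ω ∂P)]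
  ring

end Walk

end IsModel

end MERW

theorem mainTheorem10_general {Ω : Type*} [MeasurableSpace Ω] (P : Measure Ω)
    [IsProbabilityMeasure P] (d : ℕ) (hd : 1 ≤ d) (p : ℝ)
    (hp : p ≤ (2 * (d : ℝ) + 1) / (4 * (d : ℝ)))
    (X : ℕ → Ω → (Fin d → ℝ)) (A : ℕ → Ω → Matrix (Fin d) (Fin d) ℝ)
    (β : ℕ → Ω → ℕ) (Y : ℕ → Ω → ℝ) (h : MERW.IsModel P d p X A β Y)
    (α : ℝ) (hα : 1 / 2 < α) :
    ∀ᵐ ω ∂P, Tendsto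
      (fun n : ℕ => (Real.sqrt (n : ℝ) * Real.log (n : ℝ) ^ α)⁻¹ • MERW.position X A β Y n ω)
      atTop (𝓝 0) := by
  have : NeZero d := ⟨by omega⟩
  have hcoord := ae_all_iff.2 fun i =>
    h.ae_tendsto_position_apply (MERW.memoryDrift_le_half hd hp) i hα
  filter_upwards [hcoord] with ω hω
  exact tendsto_pi_nhds.2 hω

theorem mainTheorem10 {Ω : Type*} [MeasurableSpace Ω] (P : Measure Ω) [IsProbabilityMeasure P]
    (d : ℕ) (hd : 1 ≤ d) (p : ℝ) (hp : p = (2 * (d : ℝ) + 1) / (4 * (d : ℝ)))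
    (X : ℕ → Ω → (Fin d → ℝ)) (A : ℕ → Ω → Matrix (Fin d) (Fin d) ℝ)
    (β : ℕ → Ω → ℕ) (Y : ℕ → Ω → ℝ) (h : MERW.IsModel P d p X A β Y)
    (α : ℝ) (hα : 1 / 2 < α) :
    ∀ᵐ ω ∂P, Tendsto
      (fun n : ℕ => (Real.sqrt (n : ℝ) * Real.log (n : ℝ) ^ α)⁻¹ • MERW.position X A β Y n ω)
      atTop (𝓝 0) :=
  mainTheorem10_general P d hd p hp.le X A β Y h α hα
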